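/- Let $(\Omega,\mathcal F,(\mathcal F_t)_{t\ge 0},P)$ be a filtered probability space, $W$ a standard $d$-dimensional $(\mathcal F_t)$-Brownian motion, and $\Theta\subset\mathbb R^{d\times d}$ a compact convex set. Let $\mathcal A^\Theta$ be the set of progressively measurable processes $\theta:[0,\infty)\times\Omega\to\Theta$ with $E_P\int_0^T|\theta_t|^2dt<\infty$ for all $T>0$, and for $\theta\in\mathcal A^\Theta$ put $B^\theta_t=\int_0^t\theta_u\,dW_u$. A random variable $X$ of the $G$-framework is represented by the family $(X^\theta)_{\theta\in\mathcal A^\Theta}$ of its realisations under the controls: a cylinder function $\xi=\varphi(B_{t_1},B_{t_2}-B_{t_1},\dots,B_{t_n}-B_{t_{n-1}})$, with $0\le t_1<\dots<t_n\le T$ and $\varphi$ bounded and Lipschitz, is represented by $\xi^\theta=\varphi(B^\theta_{t_1},B^\theta_{t_2}-B^\theta_{t_1},\dots,B^\theta_{t_n}-B^\theta_{t_{n-1}})$, and $L^1_G(\Omega_T)$ is the completion of the cylinder functions under the norm $\sup_{\theta}E_P[|X^\theta|]$, that is, their closure among the families of $P$-integrable random variables indexed by $\mathcal A^\Theta$.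 Relations between such random variables ($X=Y$, $X\le Y$) are understood quasi-surely: $P$-almost surely under every control $\theta\in\mathcal A^\Theta$. For $0\le s\le T$ the conditional $G$-expectation $\hat{\mathbb E}_s[X]$ is given by $$\hat{\mathbb E}_s[X]^\theta=\operatorname*{ess\,sup}_{\theta'\in\mathcal A^\Theta,\ \theta'=\theta\text{ on }[0,s]}E_P\big[X^{\theta'}\,\big|\,\mathcal F_s\big],\qquad \theta\in\mathcal A^\Theta,$$ a random variable with values in $[-\infty,\infty]$. Then, for all $X,Y\in L^1_G(\Omega_T)$: 1. (Subadditivity) $\hat{\mathbb E}_s[X+Y]\le\hat{\mathbb E}_s[X]+\hat{\mathbb E}_s[Y]$. 2. (Positive homogeneity) $\hat{\mathbb E}_s[\lambda X]=\lambda\,\hat{\mathbb E}_s[X]$ for every real $\lambda\ge 0$ (with $0\cdot(\pm\infty)=0$). 3. (Preservation of constants) $\hat{\mathbb E}_s[c]=c$ for every constant $c\in\mathbb R$. 4. (Monotonicity) If $X\le Y$, then $\hat{\mathbb E}_s[X]\le\hat{\mathbb E}_s[Y]$. -/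

import Mathlib

open MeasureTheory ProbabilityTheory Filter Topology
open scoped NNReal ENNReal

namespace GExpectation

section EssentialSupremum

variable {Ω : Type*} {mΩ : MeasurableSpace Ω}

/-- `g` is the essential supremum of the (possibly uncountable) family `f` of extended real random
variables: the `P`-a.s. least `m`-measurable random variable which dominates every `f i` a.s. -/
structure IsFamilyEssSup (P : Measure Ω) (m : MeasurableSpace Ω) {ι : Type*}
    (f : ι → Ω → EReal) (g : Ω → EReal) : Prop where
  measurable : Measurable[m] g
  le : ∀ i, ∀ᵐ ω ∂P, f i ω ≤ g ω
  least : ∀ h : Ω → EReal, Measurable[m] h → (∀ i, ∀ᵐ ω ∂P, f i ω ≤ h ω) → ∀ᵐ ω ∂P, g ω ≤ h ω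

open Classical in
/-- The essential supremum of a family of `m`-measurable extended real random variables. It is
unique up to `P`-null sets, and it exists by `isFamilyEssSup_familyEssSup`. -/
noncomputable def familyEssSup (P : Measure Ω) (m : MeasurableSpace Ω) {ι : Type*}
    (f : ι → Ω → EReal) : Ω → EReal :=
  if h : ∃ g, IsFamilyEssSup P m f g then h.choose else fun _ => ⊥

theorem isFamilyEssSup_familyEssSup (P : Measure Ω) [IsFiniteMeasure P] {m : MeasurableSpace Ω}
    (hm : m ≤ mΩ) {ι : Type*} (f : ι → Ω → EReal) (hf : ∀ i, Measurable[m] (f i)) :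
    IsFamilyEssSup P m f (familyEssSup P m f) := by
  have key : ∃ g, IsFamilyEssSup P m f g := by
    classical
    -- a bounded strictly decreasing transformation of `[-∞, ∞]`
    let ψ : EReal → ℝ≥0∞ := fun x => (1 + EReal.exp x)⁻¹
    have hψanti : StrictAnti ψ := by
      intro a b hab
      refine ENNReal.inv_lt_inv.2 ?_
      exact ENNReal.add_lt_add_left ENNReal.one_ne_top (EReal.exp_strictMono hab)
    have hψmeas : Measurable ψ := hψanti.antitone.measurable
    have hψle : ∀ x, ψ x ≤ 1 := fun x => by
      simp [ψ]
    let G : Set ι → Ω → EReal := fun J ω => ⨆ i ∈ J, f i ω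
    have hGm : ∀ J : Set ι, J.Countable → Measurable[m] (G J) := fun J hJ =>
      Measurable.biSup J hJ fun i _ => hf i
    let V : Set ι → ℝ≥0∞ := fun J => ∫⁻ ω, ψ (G J ω) ∂P
    have hVfin : ∀ J, V J ≠ ∞ := fun J =>
      ((lintegral_mono fun ω => hψle _).trans_lt (by simp)).ne
    let S : Set ℝ≥0∞ := V '' {J | J.Countable}
    have hSne : S.Nonempty := ⟨V ∅, ∅, Set.countable_empty, rfl⟩
    obtain ⟨u, -, hu, huS⟩ := exists_seq_tendsto_sInf hSne (OrderBot.bddBelow S)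
    choose J hJ hJu using huS
    let K : Set ι := ⋃ n, J n
    have hK : K.Countable := Set.countable_iUnion hJ
    have hVK : V K ≤ sInf S := by
      refine ge_of_tendsto' hu fun n => ?_
      rw [← hJu n]
      refine lintegral_mono fun ω => hψanti.antitone ?_
      exact biSup_mono fun i hi => Set.mem_iUnion.2 ⟨n, hi⟩
    refine ⟨G K, hGm K hK, fun i => ?_, fun h hh hfh => ?_⟩
    · have hK' : (insert i K).Countable := hK.insert i
      have hle : ∀ ω, ψ (G (insert i K) ω) ≤ ψ (G K ω) := fun ω =>
        hψanti.antitone (biSup_mono fun j hj => Set.mem_insert_of_mem i hj)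
      have hVle : V K ≤ V (insert i K) := hVK.trans (sInf_le ⟨_, hK', rfl⟩)
      have hae := ae_eq_of_ae_le_of_lintegral_le (ae_of_all P hle) (hVfin _)
        (hψmeas.comp ((hGm K hK).mono hm le_rfl)).aemeasurable hVle
      filter_upwards [hae] with ω hω
      rw [← hψanti.injective hω]
      exact le_biSup (fun j => f j ω) (Set.mem_insert i K)
    · filter_upwards [(ae_ball_iff hK).2 fun i _ => hfh i] with ω hω
      exact iSup₂_le hω
  rw [familyEssSup, dif_pos key]
  exact key.choose_spec

end EssentialSupremum

section Controls

variable {Ω : Type*} {mΩ : MeasurableSpace Ω} {d : ℕ}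

/-- `W` is a standard `d`-dimensional Brownian motion with respect to the filtration `F`. -/
structure IsBrownianMotion (P : Measure Ω) (F : Filtration ℝ≥0 mΩ)
    (W : ℝ≥0 → Ω → Fin d → ℝ) : Prop where
  adapted : ∀ t, Measurable[F t] (W t)
  zero : ∀ᵐ ω ∂P, W 0 ω = 0
  continuous : ∀ᵐ ω ∂P, Continuous fun t => W t ω
  law : ∀ s t, s ≤ t →
    P.map (fun ω => W t ω - W s ω) = Measure.pi fun _ : Fin d => gaussianReal 0 (t - s)
  indep : ∀ s t, s ≤ t →
    Indep (MeasurableSpace.comap (fun ω => W t ω - W s ω) inferInstance) (F s) P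

/-- The squared distance `E ∫₀ᵀ |θ_u - H_u|² du` of two matrix-valued processes, with the Euclidean
(Frobenius) norm of matrices. -/
noncomputable def sqDist (P : Measure Ω) (T : ℝ≥0) (θ H : ℝ≥0 → Ω → Matrix (Fin d) (Fin d) ℝ) :
    ℝ≥0∞ :=
  ∫⁻ ω, (∫⁻ u in Set.Icc (0 : ℝ) T, ∑ i, ∑ j, ‖θ u.toNNReal ω i j - H u.toNNReal ω i j‖ₑ ^ 2) ∂P

/-- Admissible controls: progressively measurable `Θ`-valued processes, square integrable on
bounded time intervals. -/
structure Control (P : Measure Ω) (F : Filtration ℝ≥0 mΩ)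
    (Θ : Set (Matrix (Fin d) (Fin d) ℝ)) where
  toFun : ℝ≥0 → Ω → Matrix (Fin d) (Fin d) ℝ
  mem : ∀ t ω, toFun t ω ∈ Θ
  progressive : ∀ i j, IsProgressive F fun t ω => toFun t ω i j
  sq_integrable : ∀ T : ℝ≥0, sqDist P T toFun (fun _ _ => 0) < ∞

/-- Simple (elementary) integrands `∑ₖ ξₖ 1_{(tₖ, tₖ₊₁]}` with `ξₖ` bounded and
`F_{tₖ}`-measurable. -/
structure SimpleIntegrand (F : Filtration ℝ≥0 mΩ) (d : ℕ) where
  n : ℕ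
  time : Fin (n + 1) → ℝ≥0
  time_mono : Monotone time
  coeff : Fin n → Ω → Matrix (Fin d) (Fin d) ℝ
  coeff_measurable : ∀ k i j, Measurable[F (time k.castSucc)] fun ω => coeff k ω i j
  coeff_bounded : ∃ C : ℝ, ∀ k ω i j, |coeff k ω i j| ≤ C

/-- The process `∑ₖ ξₖ 1_{(tₖ, tₖ₊₁]}(u)`. -/
noncomputable def SimpleIntegrand.process {F : Filtration ℝ≥0 mΩ} (H : SimpleIntegrand F d)
    (u : ℝ≥0) (ω : Ω) : Matrix (Fin d) (Fin d) ℝ :=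
  ∑ k : Fin H.n, (Set.Ioc (H.time k.castSucc) (H.time k.succ)).indicator (fun _ => H.coeff k ω) u

/-- The elementary integral `∑ₖ ξₖ (W_{tₖ₊₁ ∧ t} - W_{tₖ ∧ t})`. -/
noncomputable def SimpleIntegrand.integral {F : Filtration ℝ≥0 mΩ} (H : SimpleIntegrand F d)
    (W : ℝ≥0 → Ω → Fin d → ℝ) (t : ℝ≥0) (ω : Ω) : Fin d → ℝ :=
  ∑ k : Fin H.n,
    (H.coeff k ω).mulVec (W (min (H.time k.succ) t) ω - W (min (H.time k.castSucc) t) ω)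

/-- `I` is (a version of) the Itô integral `∫₀ᵗ θ_u dW_u`: the `L²`-limit of the elementary
integrals of simple integrands which approximate `θ` in `L²([0,t] × Ω)`. -/
def IsItoIntegral (P : Measure Ω) (F : Filtration ℝ≥0 mΩ) (W : ℝ≥0 → Ω → Fin d → ℝ)
    (θ : ℝ≥0 → Ω → Matrix (Fin d) (Fin d) ℝ) (t : ℝ≥0) (I : Ω → Fin d → ℝ) : Prop :=
  (∀ i, MemLp (fun ω => I ω i) 2 P) ∧
    ∃ H : ℕ → SimpleIntegrand F d,
      Tendsto (fun n => sqDist P t θ (H n).process) atTop (𝓝 0) ∧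
      ∀ i, Tendsto (fun n => eLpNorm (fun ω => I ω i - (H n).integral W t ω i) 2 P) atTop (𝓝 0)

open Classical in
/-- The controlled process `B^θ_t = ∫₀ᵗ θ_u dW_u`, defined up to `P`-null sets. -/
noncomputable def controlled {P : Measure Ω} {F : Filtration ℝ≥0 mΩ}
    {Θ : Set (Matrix (Fin d) (Fin d) ℝ)} (W : ℝ≥0 → Ω → Fin d → ℝ) (θ : Control P F Θ) (t : ℝ≥0) :
    Ω → Fin d → ℝ :=
  if h : ∃ I, IsItoIntegral P F W θ.toFun t I then h.choose else 0

/-- The data of a cylinder function `φ(B_{t₁}, B_{t₂} - B_{t₁}, …, B_{tₙ} - B_{tₙ₋₁})` with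
`0 ≤ t₁ < ⋯ < tₙ ≤ T` and `φ` bounded and Lipschitz. -/
structure Cylinder (d : ℕ) (T : ℝ≥0) where
  n : ℕ
  time : Fin n → ℝ≥0
  time_strictMono : StrictMono time
  time_le : ∀ k, time k ≤ T
  φ : (Fin n → Fin d → ℝ) → ℝ
  lipschitz : ∃ K : ℝ≥0, LipschitzWith K φ
  bounded : ∃ C : ℝ, ∀ x, |φ x| ≤ C

/-- The increments `(x_{t₁}, x_{t₂} - x_{t₁}, …, x_{tₙ} - x_{tₙ₋₁})` of a path `x`. -/
def increments {n : ℕ} (time : Fin n → ℝ≥0) (x : ℝ≥0 → Fin d → ℝ) (k : Fin n) : Fin d → ℝ :=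
  if k.val = 0 then x (time k)
  else x (time k) - x (time ⟨k.val - 1, (Nat.sub_le _ _).trans_lt k.isLt⟩)

/-- The random variable `ξ^θ = φ(B^θ_{t₁}, B^θ_{t₂} - B^θ_{t₁}, …)`. A random variable `X` of the
`G`-framework is represented by the family `θ ↦ X^θ` of its realisations under all controls. -/
noncomputable def Cylinder.eval {P : Measure Ω} {F : Filtration ℝ≥0 mΩ}
    {Θ : Set (Matrix (Fin d) (Fin d) ℝ)} {T : ℝ≥0} (W : ℝ≥0 → Ω → Fin d → ℝ) (ξ : Cylinder d T)
    (θ : Control P F Θ) (ω : Ω) : ℝ :=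
  ξ.φ (increments ξ.time fun t => controlled W θ t ω)

/-- Membership in `L¹_G(Ω_T)`, the completion of the cylinder functions under the norm
`Ê[|X|] = sup_θ E_P[|X^θ|]`, realised as their closure among the families of integrable random
variables indexed by the controls. -/
def MemL1G {P : Measure Ω} {F : Filtration ℝ≥0 mΩ}
    {Θ : Set (Matrix (Fin d) (Fin d) ℝ)} (W : ℝ≥0 → Ω → Fin d → ℝ) (T : ℝ≥0)
    (X : Control P F Θ → Ω → ℝ) : Prop :=
  (∀ θ, Integrable (X θ) P) ∧
    ∀ ε : ℝ, 0 < ε → ∃ ξ : Cylinder d T, ∀ θ, ∫ ω, |X θ ω - ξ.eval W θ ω| ∂P ≤ ε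

/-- The controls which agree with `θ` up to time `s`: after time `s` they are arbitrary admissible
controls, while the path of `B^θ` up to time `s` is kept. -/
def Continuations {P : Measure Ω} {F : Filtration ℝ≥0 mΩ}
    {Θ : Set (Matrix (Fin d) (Fin d) ℝ)} (s : ℝ≥0) (θ : Control P F Θ) : Type _ :=
  {θ' : Control P F Θ // ∀ u ≤ s, ∀ ω, θ'.toFun u ω = θ.toFun u ω}

/-- The conditional `G`-expectation `Ê_s[X] = sup_{θ'} E_P[X^{θ'} | F_s]`, an essential supremum
over the controls after time `s`. It is again represented by the family of its realisations
under the controls `θ`, and depends on `θ` only through its restriction to `[0, s]`. -/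
noncomputable def condGExp {P : Measure Ω} {F : Filtration ℝ≥0 mΩ}
    {Θ : Set (Matrix (Fin d) (Fin d) ℝ)} (s : ℝ≥0) (X : Control P F Θ → Ω → ℝ)
    (θ : Control P F Θ) : Ω → EReal :=
  familyEssSup P (F s) fun (θ' : Continuations s θ) ω => ((P[X θ'.1 | F s] ω : ℝ) : EReal)

end Controls

end GExpectation

namespace GExpectation

section ConditionalExpectation

variable {Ω : Type*} {mΩ : MeasurableSpace Ω} {d : ℕ} {P : Measure Ω} [IsProbabilityMeasure P]
  {F : Filtration ℝ≥0 mΩ} {Θ : Set (Matrix (Fin d) (Fin d) ℝ)}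

/-! For each fixed continuation `θ'`, conditional expectation given `F s` is linear, monotone and
fixes constants. An essential supremum is a least upper bound up to null sets, so an upper estimate
of `condGExp` only needs an `F s`-measurable bound that dominates every member of the family a.s.
Each property is thus checked one control at a time, and no maximising control or sequence is
needed. -/

/-- Every control is a continuation of itself. -/
def Continuations.refl (s : ℝ≥0) (θ : Control P F Θ) : Continuations s θ :=
  ⟨θ, fun _ _ _ => rfl⟩

/-- Replaces the choice in the definition by its universal property; the later proofs use only `le`,
`least` and `measurable`. -/
theorem isFamilyEssSup_condGExp (s : ℝ≥0) (X : Control P F Θ → Ω → ℝ) (θ : Control P F Θ) :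
    IsFamilyEssSup P (F s)
      (fun (θ' : Continuations s θ) ω => ((P[X θ'.1 | F s] ω : ℝ) : EReal)) (condGExp s X θ) :=
  isFamilyEssSup_familyEssSup P (F.le s) _ fun _ =>
    measurable_coe_real_ereal.comp stronglyMeasurable_condExp.measurable

theorem condGExp_mono {s : ℝ≥0} {X Y : Control P F Θ → Ω → ℝ}
    (hX : ∀ θ, Integrable (X θ) P) (hY : ∀ θ, Integrable (Y θ) P)
    (hXY : ∀ θ, X θ ≤ᵐ[P] Y θ) (θ : Control P F Θ) :
    condGExp s X θ ≤ᵐ[P] condGExp s Y θ := by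
  refine (isFamilyEssSup_condGExp s X θ).least _ (isFamilyEssSup_condGExp s Y θ).measurable
    fun θ' => ?_
  filter_upwards [(isFamilyEssSup_condGExp s Y θ).le θ',
    condExp_mono (m := F s) (hX θ'.1) (hY θ'.1) (hXY θ'.1)] with ω h₁ h₂
  exact (EReal.coe_le_coe_iff.2 h₂).trans h₁

/-- On the left one `θ'` serves both terms, while on the right each term is maximised separately.
The sum is a.s. never of the form `⊥ + ⊤`, as each summand dominates a real conditional expectation.
-/
theorem condGExp_add_le {s : ℝ≥0} {X Y : Control P F Θ → Ω → ℝ}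
    (hX : ∀ θ, Integrable (X θ) P) (hY : ∀ θ, Integrable (Y θ) P) (θ : Control P F Θ) :
    ∀ᵐ ω ∂P, condGExp s (X + Y) θ ω ≤ condGExp s X θ ω + condGExp s Y θ ω := by
  have hgX := isFamilyEssSup_condGExp s X θ
  have hgY := isFamilyEssSup_condGExp s Y θ
  refine (isFamilyEssSup_condGExp s (X + Y) θ).least _ (hgX.measurable.add hgY.measurable)
    fun θ' => ?_
  filter_upwards [hgX.le θ', hgY.le θ', condExp_add (hX θ'.1) (hY θ'.1) (F s)] with ω h₁ h₂ h₃
  rw [Pi.add_apply, h₃, Pi.add_apply, EReal.coe_add]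
  exact add_le_add h₁ h₂

theorem condGExp_const (s : ℝ≥0) (c : ℝ) (θ : Control P F Θ) :
    ∀ᵐ ω ∂P, condGExp s (fun _ _ => c) θ ω = (c : EReal) := by
  have hg := isFamilyEssSup_condGExp s (fun (_ : Control P F Θ) (_ : Ω) => c) θ
  simp only [condExp_const (F.le s)] at hg
  -- The lower bound needs a nonempty family, since an empty one would have essential supremum `⊥`;
  -- `θ` itself is a member.
  filter_upwards [hg.le (Continuations.refl s θ),
    hg.least (fun _ => (c : EReal)) measurable_const fun _ => ae_of_all P fun _ => le_rfl]
    with ω h₁ h₂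
  exact le_antisymm h₂ h₁

theorem condGExp_smul_le (s : ℝ≥0) (X : Control P F Θ → Ω → ℝ) {c : ℝ} (hc : 0 ≤ c)
    (θ : Control P F Θ) :
    ∀ᵐ ω ∂P, condGExp s (c • X) θ ω ≤ (c : EReal) * condGExp s X θ ω := by
  have hg := isFamilyEssSup_condGExp s X θ
  refine (isFamilyEssSup_condGExp s (c • X) θ).least _ (measurable_const.mul hg.measurable)
    fun θ' => ?_
  filter_upwards [hg.le θ', condExp_smul (μ := P) c (X θ'.1) (F s)] with ω h₁ h₂
  rw [Pi.smul_apply, h₂, Pi.smul_apply, smul_eq_mul, EReal.coe_mul]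
  exact mul_le_mul_of_nonneg_left h₁ (EReal.coe_nonneg.2 hc)

theorem condGExp_smul (s : ℝ≥0) (X : Control P F Θ → Ω → ℝ) {c : ℝ} (hc : 0 ≤ c)
    (θ : Control P F Θ) :
    ∀ᵐ ω ∂P, condGExp s (c • X) θ ω = (c : EReal) * condGExp s X θ ω := by
  -- At `c = 0` there is no inverse to scale back with; `0 * ⊤ = 0` in `EReal` reduces this case to
  -- constants.
  rcases hc.eq_or_lt with rfl | hpos
  · have hzero : (0 : ℝ) • X = fun _ _ => 0 := zero_smul ℝ X
    filter_upwards [condGExp_const s 0 θ] with ω hω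
    rw [hzero, hω, EReal.coe_zero, zero_mul]
  · filter_upwards [condGExp_smul_le s X hc θ,
      condGExp_smul_le s (c • X) (inv_nonneg.2 hc) θ] with ω h₁ h₂
    refine le_antisymm h₁ ?_
    -- Scaling `c • X` by `c⁻¹` gives back `X`, so the one-sided bound also yields the reverse
    -- inequality.
    rw [inv_smul_smul₀ hpos.ne'] at h₂
    calc (c : EReal) * condGExp s X θ ω
        ≤ c * ((c⁻¹ : ℝ) * condGExp s (c • X) θ ω) :=
          mul_le_mul_of_nonneg_left h₂ (EReal.coe_nonneg.2 hc)
      _ = condGExp s (c • X) θ ω := by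
          rw [← mul_assoc, ← EReal.coe_mul, mul_inv_cancel₀ hpos.ne', EReal.coe_one, one_mul]

end ConditionalExpectation

end GExpectation

theorem mainTheorem11 {Ω : Type*} {mΩ : MeasurableSpace Ω} (P : Measure Ω) [IsProbabilityMeasure P]
    (F : Filtration ℝ≥0 mΩ) {d : ℕ} (W : ℝ≥0 → Ω → Fin d → ℝ)
    (hW : GExpectation.IsBrownianMotion P F W)
    (Θ : Set (Matrix (Fin d) (Fin d) ℝ)) (hΘ : IsCompact Θ) (hΘc : Convex ℝ Θ)
    (s T : ℝ≥0) (hsT : s ≤ T) :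
    -- subadditivity
    (∀ X Y : GExpectation.Control P F Θ → Ω → ℝ,
      GExpectation.MemL1G W T X → GExpectation.MemL1G W T Y →
      ∀ θ, ∀ᵐ ω ∂P, GExpectation.condGExp s (X + Y) θ ω ≤
        GExpectation.condGExp s X θ ω + GExpectation.condGExp s Y θ ω) ∧
    -- positive homogeneity
    (∀ X : GExpectation.Control P F Θ → Ω → ℝ, GExpectation.MemL1G W T X →
      ∀ c : ℝ, 0 ≤ c → ∀ θ, ∀ᵐ ω ∂P, GExpectation.condGExp s (c • X) θ ω =
        (c : EReal) * GExpectation.condGExp s X θ ω) ∧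
    -- preservation of constants
    (∀ c : ℝ, ∀ θ : GExpectation.Control P F Θ, ∀ᵐ ω ∂P,
      GExpectation.condGExp s (fun _ _ => c) θ ω = (c : EReal)) ∧
    -- monotonicity
    (∀ X Y : GExpectation.Control P F Θ → Ω → ℝ,
      GExpectation.MemL1G W T X → GExpectation.MemL1G W T Y →
      (∀ θ, ∀ᵐ ω ∂P, X θ ω ≤ Y θ ω) →
      ∀ θ, ∀ᵐ ω ∂P, GExpectation.condGExp s X θ ω ≤ GExpectation.condGExp s Y θ ω) := by
  exact ⟨fun _ _ hX hY => GExpectation.condGExp_add_le hX.1 hY.1,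
    fun X _ _ hc => GExpectation.condGExp_smul s X hc,
    GExpectation.condGExp_const s,
    fun _ _ hX hY => GExpectation.condGExp_mono hX.1 hY.1⟩
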